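/- All vector spaces are over $\mathbb{C}$. Let $V=(V,Y,\mathbf 1,\omega)$ be a vertex operator algebra: a vertex algebra (vacuum, creation and Jacobi identity, with $Y(u,x)v=\sum_{n\in\mathbb Z}u_nv\,x^{-n-1}\in V((x))$) with a conformal vector $\omega$ whose modes $L(n)=\omega_{n+1}$ satisfy the Virasoro relations, such that $V=\coprod_{n\in\mathbb{Z}}V_{(n)}$ with $V_{(n)}=\{v: L(0)v=nv\}$ finite dimensional and zero for $n$ sufficiently negative, and $Y(L(-1)u,x)=\frac{d}{dx}Y(u,x)$. Let $g$ be an automorphism of $V$, i.e. an invertible linear map with $g\mathbf 1=\mathbf 1$, $g\omega=\omega$ and $gY(u,x)v=Y(gu,x)gv$ for all $u,v\in V$. Let $\mathcal L=\mathcal S+\mathcal N$ be the operator on $V$ preserving each $V_{(n)}$ with $g=e^{2\pi i\mathcal L}$, where $\mathcal S$ is semisimple with eigenvalues of real part in $[0,1)$, $\mathcal N$ is locally nilpotent, and $\mathcal S\mathcal N=\mathcal N\mathcal S$; thus, $\mathcal S$ acts as $\alpha$ on the generalized eigenspace of $g$ with eigenvalue $e^{2\pi i\alpha}$, $0\le\operatorname{Re}\alpha<1$.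 For a vector space $M$, let $M\{x\}[\log x]$ be the space of finite sums $\sum_{k=0}^K\sum_{n\in\mathbb C}a(n,k)x^n(\log x)^k$ with $a(n,k)\in M$ (arbitrary complex powers of $x$), and put $$e^{2\pi i x\frac{d}{dx}}\sum_{k,n}a(n,k)x^n(\log x)^k=\sum_{k,n}a(n,k)e^{2\pi i n}x^n(\log x+2\pi i)^k,\qquad \frac{d}{dx}=\frac{\partial}{\partial x}+x^{-1}\frac{\partial}{\partial(\log x)}.$$ A weak $g$-twisted $V$-module is a vector space $W$ with a linear map $Y_W:V\to(\operatorname{End}W)\{x\}[\log x]$, $Y_W(u,x)=\sum_{k=0}^{K}\sum_{n\in\mathbb C}u(n,k)x^{-n-1}(\log x)^k$ (where $K$ may depend on $u$), such that: 1. (lower truncation) for all $u\in V$, $w\in W$, $n\in\mathbb C$, $k\in\mathbb Z_{\ge0}$, one has $u(n+l,k)w=0$ for all sufficiently large $l\in\mathbb Z$; 2. (identity) $Y_W(\mathbf 1,x)=\mathrm{id}_W$; 3. (twisted Jacobi identity) for all $u,v\in V$, $$x_0^{-1}\delta\!\left(\tfrac{x_1-x_2}{x_0}\right)Y_W(u,x_1)Y_W(v,x_2)-x_0^{-1}\delta\!\left(\tfrac{-x_2+x_1}{x_0}\right)Y_W(v,x_2)Y_W(u,x_1)=x_1^{-1}\delta\!\left(\tfrac{x_2+x_0}{x_1}\right)Y_W\!\left(Y\!\left(\left(\tfrac{x_2+x_0}{x_1}\right)^{\mathcal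 L}u,x_0\right)v,x_2\right),$$ where $\delta(x)=\sum_{n\in\mathbb Z}x^n$, binomials are expanded in nonnegative integral powers of the second variable, and $\left(\tfrac{x_2+x_0}{x_1}\right)^{\mathcal L}=x_1^{-\mathcal S}e^{-(\log x_1)\mathcal N}\,x_2^{\mathcal S}e^{(\log x_2)\mathcal N}\sum_{i\ge0}\binom{\mathcal L}{i}x_0^ix_2^{-i}$; 4. (equivariance) $e^{2\pi i x\frac{d}{dx}}Y_W(gu,x)=Y_W(u,x)$ for all $u\in V$. Then every weak $g$-twisted $V$-module $W$ satisfies the $L(-1)$-derivative property $$Y_W(L(-1)u,x)=\frac{d}{dx}Y_W(u,x)\qquad\text{for all }u\in V.$$ -/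

import Mathlib

noncomputable section

/-! ### Vertex operator algebras -/

/-- A vertex algebra `(V, Y, 𝟏)` over `ℂ`.  For each `u`, `Y u` is a linear map `V → V((x))`; its
normalized coefficients `u_n = VertexOperator.ncoeff (Y u) n` are given by
`Y(u, x) = ∑ n, u_n x ^ (-n-1)`. -/
structure VertexAlgebra (V : Type*) [AddCommGroup V] [Module ℂ V] where
  /-- The vertex operator map. -/
  Y : V →ₗ[ℂ] VertexOperator ℂ V
  /-- The vacuum vector. -/
  one : V
  /-- Vacuum property: `Y(𝟏, x) = id`. -/
  vacuum : ∀ (n : ℤ) (v : V), VertexOperator.ncoeff (Y one) n v = if n = -1 then v else 0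
  /-- Creation property: `Y(v, x)𝟏` is a power series in `x` ... -/
  creation_regular : ∀ (v : V) (n : ℤ), 0 ≤ n → VertexOperator.ncoeff (Y v) n one = 0
  /-- ... with constant term `v`. -/
  creation : ∀ v : V, VertexOperator.ncoeff (Y v) (-1) one = v
  /-- The Jacobi identity
  `x₀⁻¹δ((x₁-x₂)/x₀) Y(u,x₁)Y(v,x₂)w - x₀⁻¹δ((-x₂+x₁)/x₀) Y(v,x₂)Y(u,x₁)w
    = x₁⁻¹δ((x₂+x₀)/x₁) Y(Y(u,x₀)v,x₂)w`:
  equality of the coefficients of `x₀^(-l-1) x₁^(-p-1) x₂^(-q-1)`.  All sums are finite, since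
  Laurent series are truncated from below. -/
  jacobi : ∀ (u v w : V) (l p q : ℤ),
    (∑ᶠ i : ℕ, ((-1 : ℤ) ^ i * Ring.choose l i) •
        VertexOperator.ncoeff (Y u) (p + l - i) (VertexOperator.ncoeff (Y v) (q + i) w))
      - (∑ᶠ i : ℕ, (((l - i).negOnePow : ℤ) * Ring.choose l i) •
        VertexOperator.ncoeff (Y v) (q + l - i) (VertexOperator.ncoeff (Y u) (p + i) w))
    = ∑ᶠ i : ℕ, Ring.choose p i •
        VertexOperator.ncoeff (Y (VertexOperator.ncoeff (Y u) (l + i) v)) (p + q - i) w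

namespace VertexAlgebra

variable {V : Type*} [AddCommGroup V] [Module ℂ V]

/-- The mode `u_n ∈ End V`, where `Y(u, x) = ∑ n, u_n x ^ (-n-1)`. -/
def mode (A : VertexAlgebra V) (u : V) (n : ℤ) : Module.End ℂ V :=
  VertexOperator.ncoeff (A.Y u) n

end VertexAlgebra

/-- A vertex operator algebra `(V, Y, 𝟏, ω)`: a vertex algebra with a conformal vector, whose
Virasoro modes are `L(n) = ω_{n+1}`; it is graded by the eigenvalues of `L(0)`. -/
structure VertexOperatorAlgebra (V : Type*) [AddCommGroup V] [Module ℂ V] extends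
    VertexAlgebra V where
  /-- The conformal vector. -/
  omega : V
  /-- The central charge. -/
  centralCharge : ℂ
  /-- The Virasoro relations. -/
  virasoro : ∀ (m n : ℤ) (v : V),
    toVertexAlgebra.mode omega (m + 1) (toVertexAlgebra.mode omega (n + 1) v)
        - toVertexAlgebra.mode omega (n + 1) (toVertexAlgebra.mode omega (m + 1) v)
      = ((m : ℂ) - n) • toVertexAlgebra.mode omega (m + n + 1) v
        + (if m + n = 0 then ((m : ℂ) ^ 3 - m) / 12 * centralCharge else 0) • v
  /-- `V` is the direct sum over `n ∈ ℤ` of the spaces `V_(n) = {v | L(0) v = n v}`. -/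
  grading : DirectSum.IsInternal
    fun n : ℤ => (toVertexAlgebra.mode omega 1).eigenspace (n : ℂ)
  /-- Each `V_(n)` is finite dimensional. -/
  finiteDimensional : ∀ n : ℤ,
    FiniteDimensional ℂ ((toVertexAlgebra.mode omega 1).eigenspace (n : ℂ))
  /-- `V_(n) = 0` for `n` sufficiently negative. -/
  bounded_below : ∃ n₀ : ℤ, ∀ n : ℤ, n < n₀ →
    (toVertexAlgebra.mode omega 1).eigenspace (n : ℂ) = ⊥
  /-- The `L(-1)`-derivative property of `V`: `Y(L(-1)u, x) = d/dx Y(u, x)`. -/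
  derivative : ∀ (u : V) (n : ℤ),
    toVertexAlgebra.mode (toVertexAlgebra.mode omega 0 u) n
      = (-n : ℂ) • toVertexAlgebra.mode u (n - 1)

namespace VertexOperatorAlgebra

variable {V : Type*} [AddCommGroup V] [Module ℂ V]

/-- The Virasoro modes `L(n) = ω_{n+1}`, so that `Y(ω, x) = ∑ n, L(n) x ^ (-n-2)`. -/
def L (A : VertexOperatorAlgebra V) (n : ℤ) : Module.End ℂ V := A.mode A.omega (n + 1)

/-- The weight space `V_(n) = {v | L(0) v = n v}`. -/
def weightSpace (A : VertexOperatorAlgebra V) (n : ℤ) : Submodule ℂ V :=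
  (A.L 0).eigenspace (n : ℂ)

/-- An automorphism of a vertex operator algebra. -/
structure Aut (A : VertexOperatorAlgebra V) extends V ≃ₗ[ℂ] V where
  map_one : toLinearEquiv A.one = A.one
  map_omega : toLinearEquiv A.omega = A.omega
  map_mode : ∀ (u v : V) (n : ℤ),
    toLinearEquiv (A.mode u n v) = A.mode (toLinearEquiv u) n (toLinearEquiv v)

end VertexOperatorAlgebra

/-! ### The logarithm `ℒ = 𝒮 + 𝒩` of an automorphism -/

/-- The strip `0 ≤ Re α < 1`, in which the eigenvalues of `𝒮` are chosen. -/
abbrev LogStrip : Type := {α : ℂ // 0 ≤ α.re ∧ α.re < 1}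

namespace VertexOperatorAlgebra.Aut

variable {V : Type*} [AddCommGroup V] [Module ℂ V] {A : VertexOperatorAlgebra V}

/-- `g` as a linear endomorphism of `V`. -/
def toEnd (g : A.Aut) : Module.End ℂ V := g.toLinearEquiv.toLinearMap

/-- `V^[α]`: the generalized eigenspace of `g` with eigenvalue `e^{2πiα}`. -/
def genSpace (g : A.Aut) (α : LogStrip) : Submodule ℂ V :=
  g.toEnd.maxGenEigenspace (Complex.exp (2 * Real.pi * Complex.I * α))

theorem exp_injective : Function.Injective
    fun α : LogStrip => Complex.exp (2 * Real.pi * Complex.I * (α : ℂ)) := by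
  rintro ⟨α, hα0, hα1⟩ ⟨β, hβ0, hβ1⟩ h
  obtain ⟨n, hn⟩ := Complex.exp_eq_exp_iff_exists_int.1 h
  have hπ : (2 * Real.pi * Complex.I : ℂ) ≠ 0 := Complex.two_pi_I_ne_zero
  have h1 : α = β + n := by
    apply mul_left_cancel₀ hπ
    simp only at hn
    rw [hn]; ring
  have h2 : α.re = β.re + n := by rw [h1]; simp
  have h3 : n = 0 := by
    have a1 : (n : ℝ) < 1 := by linarith
    have a2 : (-1 : ℝ) < n := by linarith
    have a3 : n < 1 := by exact_mod_cast a1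
    have a4 : -1 < n := by exact_mod_cast a2
    omega
  apply Subtype.ext
  simp [h1, h3]

theorem exists_exp_eq {z : ℂ} (hz : z ≠ 0) :
    ∃ α : LogStrip, Complex.exp (2 * Real.pi * Complex.I * (α : ℂ)) = z := by
  have hπ : (2 * Real.pi * Complex.I : ℂ) ≠ 0 := Complex.two_pi_I_ne_zero
  set a : ℂ := Complex.log z / (2 * Real.pi * Complex.I) with ha
  have hre : (a - (⌊a.re⌋ : ℤ)).re = a.re - ⌊a.re⌋ := by simp
  refine ⟨⟨a - (⌊a.re⌋ : ℤ), ?_, ?_⟩, ?_⟩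
  · rw [hre]; linarith [Int.floor_le a.re]
  · rw [hre]; linarith [Int.lt_floor_add_one a.re]
  · have h1 : 2 * Real.pi * Complex.I * (a - (⌊a.re⌋ : ℤ))
        = Complex.log z - (⌊a.re⌋ : ℤ) * (2 * Real.pi * Complex.I) := by
      rw [ha]; field_simp
    simp only
    rw [h1, Complex.exp_sub, Complex.exp_log hz, Complex.exp_int_mul_two_pi_mul_I, div_one]

theorem toEnd_mem_weightSpace (g : A.Aut) (n : ℤ) (v : V) (hv : v ∈ A.weightSpace n) :
    g.toEnd v ∈ A.weightSpace n := by
  simp only [weightSpace, L, Module.End.mem_eigenspace_iff] at hv ⊢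
  have h := g.map_mode A.omega v (0 + 1)
  rw [g.map_omega, hv, map_smul] at h
  exact h.symm

theorem iSup_genSpace (g : A.Aut) : ⨆ α, g.genSpace α = ⊤ := by
  have hle : ∀ z : ℂ, g.toEnd.maxGenEigenspace z ≤ ⨆ α, g.genSpace α := by
    intro z
    by_cases hz : z = 0
    · subst hz
      intro v hv
      obtain ⟨k, hk⟩ := (Module.End.mem_maxGenEigenspace _ _ _).1 hv
      rw [zero_smul, sub_zero, Module.End.pow_apply] at hk
      have hinj : Function.Injective (g.toEnd)^[k] :=
        Function.Injective.iterate g.toLinearEquiv.injective k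
      have hv0 : v = 0 := hinj (by rw [hk, ← Module.End.pow_apply, map_zero])
      rw [hv0]
      exact zero_mem _
    · obtain ⟨α, rfl⟩ := exists_exp_eq hz
      exact le_iSup g.genSpace α
  rw [eq_top_iff, ← A.grading.submodule_iSup_eq_top]
  refine iSup_le fun n => ?_
  have : FiniteDimensional ℂ (A.weightSpace n) := A.finiteDimensional n
  have hmap : ∀ v ∈ A.weightSpace n, g.toEnd v ∈ A.weightSpace n := g.toEnd_mem_weightSpace n
  have htop := Module.End.iSup_maxGenEigenspace_eq_top (g.toEnd.restrict hmap)
  have h2 : A.weightSpace n = (⊤ : Submodule ℂ (A.weightSpace n)).map (A.weightSpace n).subtype := by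
    simp
  change A.weightSpace n ≤ _
  rw [h2, ← htop, Submodule.map_iSup]
  refine iSup_le fun z => le_trans ?_ (hle z)
  rw [Submodule.map_le_iff_le_comap, Module.End.maxGenEigenspace, Module.End.genEigenspace_restrict]

theorem isInternal_genSpace (g : A.Aut) : DirectSum.IsInternal g.genSpace :=
  DirectSum.isInternal_submodule_of_iSupIndep_of_iSup_eq_top
    (g.toEnd.independent_maxGenEigenspace.comp exp_injective) g.iSup_genSpace

/-- The decomposition `⨁ α, V^[α] = V`. -/
def decomposition (g : A.Aut) : (DirectSum LogStrip fun α => g.genSpace α) ≃ₗ[ℂ] V :=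
  LinearEquiv.ofBijective (DirectSum.coeLinearMap g.genSpace) g.isInternal_genSpace

/-- The endomorphism of `V = ⨁ α, V^[α]` that acts on `V^[α]` as `f α`. -/
def blockEnd (g : A.Aut) (f : LogStrip → Module.End ℂ V) : Module.End ℂ V :=
  DirectSum.toModule ℂ LogStrip V (fun α => f α ∘ₗ (g.genSpace α).subtype) ∘ₗ
    g.decomposition.symm.toLinearMap

theorem blockEnd_apply (g : A.Aut) (f : LogStrip → Module.End ℂ V) (α : LogStrip) (v : V)
    (hv : v ∈ g.genSpace α) : g.blockEnd f v = f α v := by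
  have h : g.decomposition.symm v = DirectSum.lof ℂ LogStrip (fun α => g.genSpace α) α ⟨v, hv⟩ := by
    rw [LinearEquiv.symm_apply_eq]
    exact (DirectSum.coeLinearMap_lof g.genSpace (i := α) ⟨v, hv⟩).symm
  simp [blockEnd, h]

/-- The projection of `V` onto `V^[c]` along the other generalized eigenspaces; it is `0` if `c`
is not an eigenvalue of `𝒮`. -/
def proj (g : A.Aut) (c : ℂ) : Module.End ℂ V :=
  open Classical in g.blockEnd fun α => if (α : ℂ) = c then 1 else 0

/-- The semisimple part `𝒮`, which acts on `V^[α]` as the scalar `α`. -/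
def S (g : A.Aut) : Module.End ℂ V := g.blockEnd fun α => (α : ℂ) • 1

/-- `e^{-2πi𝒮} g - 1`, which acts on `V^[α]` as the nilpotent `e^{-2πiα} g - 1`. -/
def unip (g : A.Aut) : Module.End ℂ V :=
  g.blockEnd fun α => Complex.exp (-(2 * Real.pi * Complex.I * α)) • g.toEnd - 1

theorem unip_apply (g : A.Aut) (α : LogStrip) (v : V) (hv : v ∈ g.genSpace α) :
    g.unip v = Complex.exp (-(2 * Real.pi * Complex.I * α)) • g.toEnd v - v := by
  rw [unip, g.blockEnd_apply _ α v hv]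
  simp

theorem toEnd_mem_genSpace (g : A.Aut) (α : LogStrip) (v : V) (hv : v ∈ g.genSpace α) :
    g.toEnd v ∈ g.genSpace α :=
  Module.End.mapsTo_maxGenEigenspace_of_comm (Commute.refl g.toEnd) _ hv

theorem unip_mem_genSpace (g : A.Aut) (α : LogStrip) (v : V) (hv : v ∈ g.genSpace α) :
    g.unip v ∈ g.genSpace α := by
  rw [g.unip_apply α v hv]
  exact sub_mem (Submodule.smul_mem _ _ (g.toEnd_mem_genSpace α v hv)) hv

theorem genSpace_induction (g : A.Aut) {P : V → Prop}
    (h0 : P 0) (hadd : ∀ v w, P v → P w → P (v + w))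
    (hP : ∀ α : LogStrip, ∀ v ∈ g.genSpace α, P v) (v : V) : P v :=
  Submodule.iSup_induction g.genSpace (motive := P) (x := v) (by simp [g.iSup_genSpace])
    hP h0 hadd

/-- `e^{-2πi𝒮} g - 1` is locally nilpotent. -/
theorem exists_unip_pow_eq_zero (g : A.Aut) (v : V) : ∃ K : ℕ, (g.unip ^ K) v = 0 := by
  refine g.genSpace_induction (P := fun v => ∃ K : ℕ, (g.unip ^ K) v = 0) ⟨0, by simp⟩ ?_ ?_ v
  · rintro v w ⟨a, ha⟩ ⟨b, hb⟩
    refine ⟨a + b, ?_⟩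
    rw [map_add]
    nth_rewrite 1 [add_comm a b]
    rw [pow_add, pow_add, Module.End.mul_apply, Module.End.mul_apply, ha, hb]
    simp
  · intro α v hv
    obtain ⟨K, hK⟩ := (Module.End.mem_maxGenEigenspace _ _ _).1 hv
    set z := Complex.exp (2 * Real.pi * Complex.I * α) with hz
    have hz0 : z ≠ 0 := Complex.exp_ne_zero _
    have key : ∀ k : ℕ, (g.unip ^ k) v = (z⁻¹) ^ k • ((g.toEnd - z • 1) ^ k) v ∧
        ((g.toEnd - z • 1) ^ k) v ∈ g.genSpace α := by
      intro k
      induction k with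
      | zero => exact ⟨by simp, by simpa using hv⟩
      | succ k ih =>
        have hu := g.unip_apply α _ ih.2
        rw [Complex.exp_neg, ← hz] at hu
        constructor
        · rw [pow_succ', Module.End.mul_apply, ih.1, map_smul, hu, pow_succ' (g.toEnd - z • 1),
            Module.End.mul_apply, pow_succ (z⁻¹), mul_smul]
          congr 1
          simp [smul_sub, smul_smul, hz0]
        · rw [pow_succ', Module.End.mul_apply]
          simp only [LinearMap.sub_apply, LinearMap.smul_apply, Module.End.one_apply]
          exact sub_mem (g.toEnd_mem_genSpace α _ ih.2) (Submodule.smul_mem _ _ ih.2)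
    exact ⟨K, by rw [(key K).1, hK, smul_zero]⟩

theorem finite_support_unip (g : A.Aut) (f : ℕ → ℂ) (v : V) :
    (Function.support fun k => f k • (g.unip ^ k) v).Finite := by
  obtain ⟨K, hK⟩ := g.exists_unip_pow_eq_zero v
  refine (Set.finite_lt_nat K).subset fun k hk => ?_
  by_contra hlt
  apply hk
  obtain ⟨d, rfl⟩ := Nat.exists_eq_add_of_le (not_lt.1 hlt)
  simp only
  rw [add_comm, pow_add, Module.End.mul_apply, hK, map_zero, smul_zero]

/-- The value `∑ k, f_k (e^{-2πi𝒮} g - 1) ^ k` of a power series `f = ∑ k, f_k X^k`; it is a finite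
sum on each vector. -/
def unipSeries (g : A.Aut) (f : PowerSeries ℂ) : Module.End ℂ V where
  toFun v := ∑ᶠ k : ℕ, PowerSeries.coeff k f • (g.unip ^ k) v
  map_add' v w := by
    simp only [map_add, smul_add]
    exact finsum_add_distrib (g.finite_support_unip _ v) (g.finite_support_unip _ w)
  map_smul' c v := by
    simp only [map_smul, RingHom.id_apply]
    rw [smul_finsum' _ (g.finite_support_unip _ v)]
    simp only [smul_comm c]

/-- The locally nilpotent part `𝒩 = (2πi)⁻¹ log(e^{-2πi𝒮} g)`, where
`log(1 + X) = ∑ k ≥ 1, (-1)^(k+1)/k X^k`. -/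
def N (g : A.Aut) : Module.End ℂ V :=
  (2 * Real.pi * Complex.I : ℂ)⁻¹ • g.unipSeries (PowerSeries.log ℂ)

/-- `ℒ = 𝒮 + 𝒩`, the operator with `g = e^{2πiℒ}` whose eigenvalues have real part in `[0, 1)`. -/
def logEnd (g : A.Aut) : Module.End ℂ V := g.S + g.N

theorem unipSeries_apply (g : A.Aut) (f : PowerSeries ℂ) {v : V} {K : ℕ}
    (hK : (g.unip ^ K) v = 0) :
    g.unipSeries f v = ∑ k ∈ Finset.range K, PowerSeries.coeff k f • (g.unip ^ k) v := by
  refine finsum_eq_sum_of_support_subset _ fun k hk => ?_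
  by_contra hlt
  apply hk
  simp only [Finset.coe_range, Set.mem_Iio, not_lt] at hlt
  obtain ⟨d, rfl⟩ := Nat.exists_eq_add_of_le hlt
  simp only
  rw [add_comm, pow_add, Module.End.mul_apply, hK, map_zero, smul_zero]

theorem unipSeries_congr (g : A.Aut) {f h : PowerSeries ℂ} {v : V} {K : ℕ}
    (hK : (g.unip ^ K) v = 0) (hfh : ∀ k < K, PowerSeries.coeff k f = PowerSeries.coeff k h) :
    g.unipSeries f v = g.unipSeries h v := by
  rw [g.unipSeries_apply f hK, g.unipSeries_apply h hK]
  exact Finset.sum_congr rfl fun k hk => by rw [hfh k (Finset.mem_range.1 hk)]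

theorem unipSeries_coe (g : A.Aut) (p : Polynomial ℂ) :
    g.unipSeries (p : PowerSeries ℂ) = Polynomial.aeval g.unip p := by
  ext v
  have h : ∑ᶠ k : ℕ, PowerSeries.coeff k (p : PowerSeries ℂ) • (g.unip ^ k) v
      = ∑ k ∈ Finset.range (p.natDegree + 1),
        PowerSeries.coeff k (p : PowerSeries ℂ) • (g.unip ^ k) v := by
    refine finsum_eq_sum_of_support_subset _ fun k hk => ?_
    by_contra hlt
    apply hk
    simp only [Finset.coe_range, Set.mem_Iio, not_lt] at hlt
    simp only [Polynomial.coeff_coe]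
    rw [Polynomial.coeff_eq_zero_of_natDegree_lt hlt, zero_smul]
  rw [Polynomial.aeval_eq_sum_range, LinearMap.sum_apply]
  refine h.trans ?_
  simp

theorem unipSeries_mul (g : A.Aut) (f h : PowerSeries ℂ) :
    g.unipSeries (f * h) = g.unipSeries f * g.unipSeries h := by
  ext v
  obtain ⟨K, hK⟩ := g.exists_unip_pow_eq_zero v
  have hh : g.unipSeries h v = Polynomial.aeval g.unip (PowerSeries.trunc K h) v := by
    rw [← unipSeries_coe]
    exact g.unipSeries_congr hK fun k hk => (PowerSeries.coeff_coe_trunc_of_lt hk).symm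
  have hK' : (g.unip ^ K) (g.unipSeries h v) = 0 := by
    have hX : g.unip ^ K = Polynomial.aeval g.unip (Polynomial.X ^ K : Polynomial ℂ) := by simp
    rw [hh, ← Module.End.mul_apply, hX, ← map_mul, mul_comm, map_mul, ← hX,
      Module.End.mul_apply, hK, map_zero]
  have hf : g.unipSeries f (g.unipSeries h v)
      = Polynomial.aeval g.unip (PowerSeries.trunc K f) (g.unipSeries h v) := by
    rw [← unipSeries_coe]
    exact g.unipSeries_congr hK' fun k hk => (PowerSeries.coeff_coe_trunc_of_lt hk).symm
  rw [Module.End.mul_apply, hf, hh, ← Module.End.mul_apply, ← map_mul, ← unipSeries_coe]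
  refine g.unipSeries_congr hK fun k hk => ?_
  rw [Polynomial.coe_mul, PowerSeries.coeff_mul, PowerSeries.coeff_mul]
  refine Finset.sum_congr rfl fun x hx => ?_
  have := Finset.HasAntidiagonal.mem_antidiagonal.1 hx
  rw [PowerSeries.coeff_coe_trunc_of_lt (by omega), PowerSeries.coeff_coe_trunc_of_lt (by omega)]

theorem unipSeries_one (g : A.Aut) : g.unipSeries 1 = 1 := by
  simpa using g.unipSeries_coe 1

theorem unipSeries_pow (g : A.Aut) (f : PowerSeries ℂ) (n : ℕ) :
    g.unipSeries (f ^ n) = g.unipSeries f ^ n := by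
  induction n with
  | zero => simp [unipSeries_one]
  | succ n ih => rw [pow_succ, unipSeries_mul, ih, pow_succ]

theorem exp_subst_log :
    (PowerSeries.exp ℂ).subst (PowerSeries.log ℂ) = (1 + PowerSeries.X : PowerSeries ℂ) := by
  set F := (PowerSeries.exp ℂ).subst (PowerSeries.log ℂ) with hF
  have hs : PowerSeries.HasSubst (PowerSeries.log ℂ) := PowerSeries.HasSubst.log
  have hD : PowerSeries.derivative ℂ F = F * PowerSeries.derivative ℂ (PowerSeries.log ℂ) := by
    rw [hF, PowerSeries.derivative_subst hs, PowerSeries.derivative_exp]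
  have hL : PowerSeries.derivative ℂ (PowerSeries.log ℂ) * (1 + PowerSeries.X) = 1 := by
    rw [PowerSeries.deriv_log]
    ext n
    rw [mul_add, mul_one, map_add, PowerSeries.coeff_mk]
    cases n with
    | zero => simp
    | succ n => simp [PowerSeries.coeff_succ_mul_X, pow_succ]
  have h1 : PowerSeries.derivative ℂ F * (1 + PowerSeries.X) = F := by
    rw [hD, mul_assoc, hL, mul_one]
  have hc : PowerSeries.constantCoeff F = 1 := by
    rw [← PowerSeries.coeff_zero_eq_constantCoeff_apply, hF, PowerSeries.coeff_subst' hs,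
      finsum_eq_single _ 0]
    · simp
    · intro n hn
      simp [PowerSeries.constantCoeff_log, hn]
  ext n
  have key : ∀ n : ℕ, PowerSeries.coeff (n + 1) F * (n + 1) + PowerSeries.coeff n F * n
      = PowerSeries.coeff n F := by
    intro n
    have := congrArg (PowerSeries.coeff n) h1
    rw [mul_add, mul_one, map_add, PowerSeries.coeff_derivative] at this
    cases n with
    | zero => simpa using this
    | succ n =>
      rw [PowerSeries.coeff_succ_mul_X, PowerSeries.coeff_derivative] at this
      simpa using this
  have hhigh : ∀ n : ℕ, PowerSeries.coeff (n + 2) F = 0 := by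
    intro n
    induction n with
    | zero =>
      have := key 1
      norm_num at this
      simpa using this
    | succ n ih =>
      have := key (n + 2)
      rw [ih] at this
      simp only [zero_mul, add_zero, mul_eq_zero] at this
      rcases this with h | h
      · exact h
      · exact absurd h (by exact_mod_cast Nat.succ_ne_zero (n + 2))
  match n with
  | 0 => simpa using hc
  | 1 => simpa [hc, PowerSeries.coeff_one] using key 0
  | n + 2 => rw [hhigh]; simp [PowerSeries.coeff_one, PowerSeries.coeff_X]

theorem coeff_log_pow {n k : ℕ} (h : k < n) :
    PowerSeries.coeff k (PowerSeries.log ℂ ^ n) = 0 := by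
  apply PowerSeries.coeff_of_lt_order
  refine lt_of_lt_of_le ?_ (PowerSeries.le_order_pow _ n)
  rw [PowerSeries.order_log]
  simpa using h

theorem S_apply (g : A.Aut) (α : LogStrip) (v : V) (hv : v ∈ g.genSpace α) :
    g.S v = (α : ℂ) • v := by
  rw [S, g.blockEnd_apply _ α v hv]
  simp

/-- `𝒩` is locally nilpotent. -/
theorem exists_N_pow_eq_zero (g : A.Aut) (v : V) : ∃ K : ℕ, ∀ j ≥ K, (g.N ^ j) v = 0 := by
  obtain ⟨K, hK⟩ := g.exists_unip_pow_eq_zero v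
  refine ⟨K, fun j hj => ?_⟩
  rw [N, smul_pow, ← unipSeries_pow, LinearMap.smul_apply, g.unipSeries_apply _ hK,
    Finset.sum_eq_zero, smul_zero]
  intro k hk
  rw [coeff_log_pow (lt_of_lt_of_le (Finset.mem_range.1 hk) hj), zero_smul]

/-- `g = e^{2πiℒ}`: on `V^[α]`, `g = e^{2πiα} ∑ j, (2πi𝒩)^j / j!`. -/
theorem toEnd_eq_exp (g : A.Aut) (α : LogStrip) (v : V) (hv : v ∈ g.genSpace α) :
    g.toEnd v = Complex.exp (2 * Real.pi * Complex.I * α) •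
      ∑ᶠ j : ℕ, ((2 * Real.pi * Complex.I) ^ j / (j.factorial : ℂ)) • (g.N ^ j) v := by
  have hπ : (2 * Real.pi * Complex.I : ℂ) ≠ 0 := Complex.two_pi_I_ne_zero
  obtain ⟨K, hK⟩ := g.exists_unip_pow_eq_zero v
  have hterm : ∀ j : ℕ, ((2 * Real.pi * Complex.I) ^ j / (j.factorial : ℂ)) • (g.N ^ j) v
      = PowerSeries.coeff j (PowerSeries.exp ℂ) • g.unipSeries (PowerSeries.log ℂ ^ j) v := by
    intro j
    rw [N, smul_pow, ← unipSeries_pow, LinearMap.smul_apply, smul_smul, PowerSeries.coeff_exp]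
    congr 1
    rw [inv_pow]
    field_simp
    simp
  have hz : ∀ j, K ≤ j → g.unipSeries (PowerSeries.log ℂ ^ j) v = 0 := by
    intro j hj
    rw [g.unipSeries_apply _ hK, Finset.sum_eq_zero]
    intro k hk
    rw [coeff_log_pow (lt_of_lt_of_le (Finset.mem_range.1 hk) hj), zero_smul]
  have hsum : ∑ᶠ j : ℕ, ((2 * Real.pi * Complex.I) ^ j / (j.factorial : ℂ)) • (g.N ^ j) v
      = g.unipSeries (1 + PowerSeries.X) v := by
    simp only [hterm]
    rw [finsum_eq_sum_of_support_subset (s := Finset.range K), g.unipSeries_apply _ hK]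
    · simp_rw [g.unipSeries_apply _ hK, Finset.smul_sum]
      rw [Finset.sum_comm]
      refine Finset.sum_congr rfl fun k hk => ?_
      rw [← exp_subst_log, PowerSeries.coeff_subst' PowerSeries.HasSubst.log,
        finsum_eq_sum_of_support_subset (s := Finset.range K), Finset.sum_smul]
      · exact Finset.sum_congr rfl fun j _ => by rw [smul_smul, smul_eq_mul]
      · intro j hj
        by_contra hlt
        apply hj
        simp only [Finset.coe_range, Set.mem_Iio, not_lt] at hlt
        simp only
        rw [coeff_log_pow (lt_of_lt_of_le (Finset.mem_range.1 hk) hlt), smul_zero]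
    · intro j hj
      by_contra hlt
      apply hj
      simp only [Finset.coe_range, Set.mem_Iio, not_lt] at hlt
      simp only
      rw [hz j hlt, smul_zero]
  have hone : g.unipSeries (1 + PowerSeries.X) v = v + g.unip v := by
    have := g.unipSeries_coe (1 + Polynomial.X)
    simp only [Polynomial.coe_add, Polynomial.coe_one, Polynomial.coe_X, map_add,
      Polynomial.aeval_X] at this
    rw [this]
    simp
  rw [hsum, hone, g.unip_apply α v hv, Complex.exp_neg]
  simp

/-- The binomial coefficient `binom(ℒ, i) = ℒ(ℒ-1)⋯(ℒ-i+1)/i!`. -/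
def chooseLog (g : A.Aut) (i : ℕ) : Module.End ℂ V :=
  (i.factorial : ℂ)⁻¹ • Polynomial.aeval g.logEnd (descPochhammer ℂ i)

/-- The formal expression `((x₂+x₀)/x₁)^ℒ u`, where `x₁^{-ℒ} = x₁^{-𝒮} e^{-(log x₁)𝒩}` and
`(x₂+x₀)^ℒ = x₂^𝒮 e^{(log x₂)𝒩} (1+x₀/x₂)^ℒ = x₂^𝒮 e^{(log x₂)𝒩} ∑ i, binom(ℒ,i) x₀^i x₂^{-i}`:
`g.ratioPow c i j a u` is the coefficient of
`x₀^i x₁^(-c) (log x₁)^j x₂^(c-i) (log x₂)^a`, and all other coefficients vanish. -/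
def ratioPow (g : A.Aut) (c : ℂ) (i j a : ℕ) : Module.End ℂ V :=
  ((j.factorial : ℂ)⁻¹ • (-g.N) ^ j) * ((a.factorial : ℂ)⁻¹ • g.N ^ a) * g.chooseLog i * g.proj c

end VertexOperatorAlgebra.Aut

/-! ### Logarithmic formal series -/

/-- The space `M{x}[log x]` of polynomials in `log x` whose coefficients are formal series in
arbitrary complex powers of `x`: `f k n` is the coefficient of `x^n (log x)^k`. -/
abbrev LogSeries (M : Type*) [AddCommGroup M] : Type _ := ℕ →₀ (ℂ → M)

namespace LogSeries

variable {M : Type*} [AddCommGroup M] [Module ℂ M]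

/-- `x^n (log x)^k ↦ n x^(n-1) (log x)^k`, that is `∂/∂x`. -/
def partialX (f : LogSeries M) : LogSeries M :=
  f.mapRange (fun a n => (n + 1) • a (n + 1)) (by ext; simp)

/-- `x^n (log x)^k ↦ k x^n (log x)^(k-1)`, that is `∂/∂(log x)`. -/
def partialLog (f : LogSeries M) : LogSeries M :=
  f.sum fun k a => Finsupp.single (k - 1) (k • a)

/-- Multiplication by `x⁻¹`. -/
def invXMul (f : LogSeries M) : LogSeries M :=
  f.mapRange (fun a n => a (n + 1)) rfl

/-- `d/dx = ∂/∂x + x⁻¹ ∂/∂(log x)`. -/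
def deriv (f : LogSeries M) : LogSeries M := f.partialX + f.partialLog.invXMul

/-- The operator `e^{2πi x d/dx}`, taking `x` once around the origin:
`x^n (log x)^k ↦ e^{2πin} x^n (log x + 2πi)^k`. -/
def monodromy (f : LogSeries M) : LogSeries M :=
  f.sum fun k a => ∑ j ∈ Finset.range (k + 1), Finsupp.single j fun n =>
    (Complex.exp (2 * Real.pi * Complex.I * n) *
      ((k.choose j : ℂ) * (2 * Real.pi * Complex.I) ^ (k - j))) • a n

/-- The mode `u(n,k)`, where the series is written `∑ k n, u(n,k) x^(-n-1) (log x)^k`. -/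
def mode (f : LogSeries M) (n : ℂ) (k : ℕ) : M := f k (-n - 1)

end LogSeries

/-! ### Weak twisted modules -/

namespace VertexOperatorAlgebra

variable {V : Type*} [AddCommGroup V] [Module ℂ V]
variable {W : Type*} [AddCommGroup W] [Module ℂ W]

/-- The coefficient of `x₀^(-l-1) x₁^(-p-1) (log x₁)^j x₂^(-q-1) (log x₂)^k` in
`x₀⁻¹ δ((x₁-x₂)/x₀) a(x₁) b(x₂) w = ∑ l, x₀^(-l-1) (x₁-x₂)^l a(x₁) b(x₂) w`. -/
def deltaFirst (a b : LogSeries (Module.End ℂ W)) (w : W) (l : ℤ) (p q : ℂ) (j k : ℕ) : W :=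
  ∑ᶠ i : ℕ, ((-1 : ℤ) ^ i * Ring.choose l i) • a.mode (p + l - i) j (b.mode (q + i) k w)

/-- The coefficient of `x₀^(-l-1) x₁^(-p-1) (log x₁)^j x₂^(-q-1) (log x₂)^k` in
`x₀⁻¹ δ((-x₂+x₁)/x₀) b(x₂) a(x₁) w = ∑ l, x₀^(-l-1) (-x₂+x₁)^l b(x₂) a(x₁) w`. -/
def deltaSecond (a b : LogSeries (Module.End ℂ W)) (w : W) (l : ℤ) (p q : ℂ) (j k : ℕ) : W :=
  ∑ᶠ i : ℕ, (((l - i).negOnePow : ℤ) * Ring.choose l i) •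
    b.mode (q + l - i) k (a.mode (p + i) j w)

/-- The coefficient of `x₀^(-l-1) x₁^(-p-1) (log x₁)^j x₂^(-q-1) (log x₂)^k` in
`x₁⁻¹ δ((x₂+x₀)/x₁) Y_W(Y(((x₂+x₀)/x₁)^ℒ u, x₀) v, x₂) w`, where
`x₁⁻¹ δ((x₂+x₀)/x₁) = ∑ m s, binom(m,s) x₁^(-m-1) x₂^(m-s) x₀^s`.  The sum runs over `m`, over the
power `t = s + i` of `x₀` coming from the delta function (`s`) and from `((x₂+x₀)/x₁)^ℒ` (`i`), and
over the powers of `log x₂` coming from `((x₂+x₀)/x₁)^ℒ` and from `Y_W`. -/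
def deltaThird (A : VertexOperatorAlgebra V) (g : A.Aut)
    (YW : V →ₗ[ℂ] LogSeries (Module.End ℂ W)) (u v : V) (w : W)
    (l : ℤ) (p q : ℂ) (j k : ℕ) : W :=
  ∑ᶠ m : ℤ, ∑ᶠ t : ℕ,
    ∑ si ∈ Finset.HasAntidiagonal.antidiagonal t, ∑ ab ∈ Finset.HasAntidiagonal.antidiagonal k,
      Ring.choose m si.1 •
        (YW (A.mode (g.ratioPow (p - m) si.2 j ab.1 u) (l + t) v)).mode (p + q - t) ab.2 w

/-- A weak `g`-twisted `V`-module structure on the vector space `W`. -/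
structure WeakTwistedModule (A : VertexOperatorAlgebra V) (g : A.Aut)
    (W : Type*) [AddCommGroup W] [Module ℂ W] where
  /-- The twisted vertex operator map `Y_W : V → (End W){x}[log x]`. -/
  YW : V →ₗ[ℂ] LogSeries (Module.End ℂ W)
  /-- Lower truncation: `u(n+l,k)w = 0` for all sufficiently large integers `l`. -/
  lower_truncation : ∀ (u : V) (w : W) (n : ℂ) (k : ℕ),
    ∃ l₀ : ℤ, ∀ l : ℤ, l₀ ≤ l → (YW u).mode (n + l) k w = 0
  /-- Identity property: `Y_W(𝟏, x) = id_W`. -/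
  identity : ∀ (n : ℂ) (k : ℕ), YW A.one k n = if n = 0 ∧ k = 0 then 1 else 0
  /-- The twisted Jacobi identity
  `x₀⁻¹ δ((x₁-x₂)/x₀) Y_W(u,x₁) Y_W(v,x₂) - x₀⁻¹ δ((-x₂+x₁)/x₀) Y_W(v,x₂) Y_W(u,x₁)
    = x₁⁻¹ δ((x₂+x₀)/x₁) Y_W(Y(((x₂+x₀)/x₁)^ℒ u, x₀) v, x₂)`. -/
  jacobi : ∀ (u v : V) (w : W) (l : ℤ) (p q : ℂ) (j k : ℕ),
    deltaFirst (YW u) (YW v) w l p q j k - deltaSecond (YW u) (YW v) w l p q j k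
      = deltaThird A g YW u v w l p q j k
  /-- Equivariance: `e^{2πi x d/dx} Y_W(gu, x) = Y_W(u, x)`. -/
  equivariance : ∀ u : V, (YW (g.toEnd u)).monodromy = YW u

end VertexOperatorAlgebra

end

/-! Everything is read off from the twisted Jacobi identity with `v = 𝟏`, at the coefficient of
`x₂⁻¹ (log x₂)⁰`. Since `Y_W(𝟏, x₂) = id`, the first delta term has only nonnegative powers of `x₂`
and drops out, the second is explicit, and on the right the creation property `u_n 𝟏 = 0` for `n ≥
0` leaves finitely many terms. Let `u ∈ V^[α]`.

For `l = -1` the right side keeps only `u_{-1}𝟏 = u`. So the modes of `u` live on `α + ℤ`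
(`mode_eq_zero`), and `u(n,j)` is the log-free mode of `(-𝒩)^j/j! u` (`mode_eq_mode_expNegN`): the
logarithms are governed by `𝒩` alone.

For `l = -2` the left side vanishes and two terms survive on the right: `u_{-2}𝟏 = L(-1)u`, and
`u_{-1}𝟏 = u` weighted by `m` from the delta function and by `ℒ = α + 𝒩` from the twist. With `n = α
+ m` this says `(L(-1)u)(n,0) = -n u(n-1,0) - (𝒩u)(n-1,0)`, whose last term is `u(n-1,1)`; this is
the log-free part of the claim (`mode_zero_L_neg_one`).

The coefficient of `(log x)^j` follows on replacing `u` by `(-𝒩)^j/j! u`, because `𝒩` commutes with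
`L(-1)`; finally `V` is the sum of the `V^[α]`. -/

namespace VertexAlgebra

variable {V : Type*} [AddCommGroup V] [Module ℂ V]

theorem mode_one_eq_zero (A : VertexAlgebra V) (v : V) {n : ℤ} (hn : 0 ≤ n) :
    A.mode v n A.one = 0 :=
  A.creation_regular v n hn

theorem mode_neg_one_one (A : VertexAlgebra V) (v : V) : A.mode v (-1) A.one = v :=
  A.creation v

end VertexAlgebra

namespace VertexOperatorAlgebra

variable {V : Type*} [AddCommGroup V] [Module ℂ V]

/-- The derivative property of `V` at mode `-1`, applied to the vacuum, turns `(L(-1)v)_{-1}𝟏` into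
`v_{-2}𝟏`. This is how `L(-1)` enters the Jacobi identity with `v = 𝟏`. -/
theorem mode_neg_two_one (A : VertexOperatorAlgebra V) (v : V) :
    A.mode v (-2) A.one = A.L (-1) v := by
  have h := LinearMap.congr_fun (A.derivative v (-1)) A.one
  rw [A.mode_neg_one_one] at h
  have h2 : A.L (-1) v = A.mode A.omega 0 v := by simp [L]
  rw [h2, h]
  simp

/-! ### Compatibility of `𝒩` with the Virasoro modes and the generalized eigenspaces -/

namespace Aut

variable {A : VertexOperatorAlgebra V}

theorem toEnd_L (g : A.Aut) (n : ℤ) (v : V) : g.toEnd (A.L n v) = A.L n (g.toEnd v) := by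
  have h := g.map_mode A.omega v (n + 1)
  rwa [g.map_omega] at h

theorem commute_toEnd_L (g : A.Aut) (n : ℤ) : Commute g.toEnd (A.L n) :=
  LinearMap.ext fun v => g.toEnd_L n v

theorem L_mem_genSpace (g : A.Aut) (n : ℤ) {α : LogStrip} {v : V} (hv : v ∈ g.genSpace α) :
    A.L n v ∈ g.genSpace α :=
  Module.End.mapsTo_maxGenEigenspace_of_comm (g.commute_toEnd_L n) _ hv

/-- On each `V^[α]` the operator is a polynomial in `g`, and `L n` commutes with `g` (as `gω = ω`)
and preserves `V^[α]`. -/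
theorem commute_unip_L (g : A.Aut) (n : ℤ) : Commute g.unip (A.L n) := by
  refine LinearMap.ext fun v => ?_
  refine g.genSpace_induction (P := fun v => (g.unip * A.L n) v = (A.L n * g.unip) v)
    (by simp) (fun v w hv hw => by rw [map_add, map_add, hv, hw]) (fun α v hv => ?_) v
  simp only [Module.End.mul_apply]
  rw [g.unip_apply α _ (g.L_mem_genSpace n hv), g.unip_apply α v hv, g.toEnd_L, map_sub, map_smul]

theorem commute_unipSeries (g : A.Aut) (f : PowerSeries ℂ) {T : Module.End ℂ V}
    (hT : Commute g.unip T) : Commute (g.unipSeries f) T := by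
  refine LinearMap.ext fun v => ?_
  obtain ⟨K, hK⟩ := g.exists_unip_pow_eq_zero v
  have hc : ∀ k, (g.unip ^ k) (T v) = T ((g.unip ^ k) v) := fun k =>
    LinearMap.congr_fun (hT.pow_left k) v
  have hK' : (g.unip ^ K) (T v) = 0 := by rw [hc, hK, map_zero]
  simp only [Module.End.mul_apply]
  rw [g.unipSeries_apply f hK, g.unipSeries_apply f hK', map_sum]
  simp only [hc, map_smul]

theorem commute_N_L (g : A.Aut) (n : ℤ) : Commute g.N (A.L n) :=
  (g.commute_unipSeries _ (g.commute_unip_L n)).smul_left _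

theorem unip_pow_mem_genSpace (g : A.Aut) {α : LogStrip} {v : V} (hv : v ∈ g.genSpace α) (k : ℕ) :
    (g.unip ^ k) v ∈ g.genSpace α := by
  induction k with
  | zero => simpa using hv
  | succ k ih =>
    rw [pow_succ', Module.End.mul_apply]
    exact g.unip_mem_genSpace α _ ih

theorem N_mem_genSpace (g : A.Aut) {α : LogStrip} {v : V} (hv : v ∈ g.genSpace α) :
    g.N v ∈ g.genSpace α := by
  obtain ⟨K, hK⟩ := g.exists_unip_pow_eq_zero v
  rw [N, LinearMap.smul_apply, g.unipSeries_apply _ hK]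
  exact Submodule.smul_mem _ _ (Submodule.sum_mem _ fun k _ =>
    Submodule.smul_mem _ _ (g.unip_pow_mem_genSpace hv k))

/-- The coefficient `(-𝒩)^j / j!` of `(log x)^j` in `e^{-(log x)𝒩}`. -/
noncomputable def expNegN (g : A.Aut) (j : ℕ) : Module.End ℂ V := (j.factorial : ℂ)⁻¹ • (-g.N) ^ j

theorem expNegN_mem_genSpace (g : A.Aut) {α : LogStrip} {v : V} (hv : v ∈ g.genSpace α) (j : ℕ) :
    g.expNegN j v ∈ g.genSpace α := by
  refine Submodule.smul_mem _ _ ?_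
  induction j with
  | zero => simpa using hv
  | succ j ih =>
    rw [pow_succ', Module.End.mul_apply]
    exact Submodule.neg_mem _ (g.N_mem_genSpace ih)

theorem expNegN_one (g : A.Aut) : g.expNegN 1 = -g.N := by simp [expNegN]

/-- Coefficientwise form of `d/d(log x) e^{-(log x)𝒩} = -𝒩 e^{-(log x)𝒩}`; it yields the factor `j +
1` in `d/dx`. -/
theorem expNegN_one_mul (g : A.Aut) (j : ℕ) :
    g.expNegN 1 * g.expNegN j = (j + 1 : ℂ) • g.expNegN (j + 1) := by
  have h : (j + 1 : ℂ) ≠ 0 := by exact_mod_cast j.succ_ne_zero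
  rw [expNegN_one, expNegN, expNegN, mul_smul_comm, ← pow_succ', smul_smul, Nat.factorial_succ]
  congr 1
  push_cast
  field_simp

theorem expNegN_L (g : A.Aut) (j : ℕ) (n : ℤ) (v : V) :
    g.expNegN j (A.L n v) = A.L n (g.expNegN j v) :=
  LinearMap.congr_fun
    (((g.commute_N_L n).neg_left.pow_left j).smul_left (j.factorial : ℂ)⁻¹) v

/-! ### Low-order coefficients of `((x₂+x₀)/x₁)^ℒ` -/

theorem proj_apply_self (g : A.Aut) {α : LogStrip} {v : V} (hv : v ∈ g.genSpace α) :
    g.proj α v = v := by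
  rw [proj, g.blockEnd_apply _ α v hv]
  simp

theorem proj_apply_of_ne (g : A.Aut) {α : LogStrip} {c : ℂ} (hc : (α : ℂ) ≠ c) {v : V}
    (hv : v ∈ g.genSpace α) : g.proj c v = 0 := by
  rw [proj, g.blockEnd_apply _ α v hv]
  simp [hc]

theorem ratioPow_apply_of_ne (g : A.Aut) {α : LogStrip} {c : ℂ} (hc : (α : ℂ) ≠ c) {v : V}
    (hv : v ∈ g.genSpace α) (i j a : ℕ) : g.ratioPow c i j a v = 0 := by
  rw [ratioPow, Module.End.mul_apply, g.proj_apply_of_ne hc hv, map_zero]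

theorem ratioPow_zero_zero (g : A.Aut) {α : LogStrip} {v : V} (hv : v ∈ g.genSpace α) (j : ℕ) :
    g.ratioPow α 0 j 0 v = g.expNegN j v := by
  rw [ratioPow, Module.End.mul_apply, g.proj_apply_self hv]
  simp [chooseLog, expNegN]

theorem ratioPow_one_zero_zero (g : A.Aut) {α : LogStrip} {v : V} (hv : v ∈ g.genSpace α) :
    g.ratioPow α 1 0 0 v = (α : ℂ) • v + g.N v := by
  rw [ratioPow, Module.End.mul_apply, g.proj_apply_self hv]
  simp [chooseLog, logEnd, g.S_apply α v hv]

end Aut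

end VertexOperatorAlgebra

/-! ### Modes of the formal derivative -/

namespace LogSeries

variable {M : Type*} [AddCommGroup M]

theorem partialLog_apply (f : LogSeries M) (k : ℕ) : f.partialLog k = (k + 1) • f (k + 1) := by
  classical
  rw [partialLog, Finsupp.sum_apply, Finsupp.sum]
  rw [Finset.sum_eq_single (k + 1)]
  · simp
  · intro b _ hb
    -- For `b = 0` the truncated `0 - 1` lands on index `0`, but the factor `0 • a` kills the term.
    rcases b with _ | b
    · simp
    · rw [Finsupp.single_apply, if_neg (by omega)]
  · intro h
    rw [Finsupp.notMem_support_iff.1 h]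
    simp

/-- Mode `n` sits at `x^(-n-1)`, so both parts of `d/dx` draw on the exponent `-n`, which is mode `n
- 1`. -/
theorem deriv_mode [Module ℂ M] (f : LogSeries M) (n : ℂ) (k : ℕ) :
    f.deriv.mode n k = -n • f.mode (n - 1) k + (k + 1 : ℂ) • f.mode (n - 1) (k + 1) := by
  have h1 : -n - 1 + 1 = -(n - 1) - 1 := by ring
  have h2 : -(n - 1) - 1 + 1 = -n + 1 := by ring
  simp only [mode, deriv, Finsupp.add_apply, Pi.add_apply, invXMul, partialX,
    Finsupp.mapRange_apply, partialLog_apply, Pi.smul_apply, h1]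
  rw [← Nat.cast_smul_eq_nsmul ℂ]
  push_cast
  congr 2
  ring

theorem ext_mode {f h : LogSeries M} (H : ∀ n k, f.mode n k = h.mode n k) : f = h := by
  ext k n
  simpa [mode] using H (-n - 1) k

end LogSeries

/-! ### The twisted Jacobi identity with the vacuum as second vector -/

namespace VertexOperatorAlgebra.WeakTwistedModule

variable {V : Type*} [AddCommGroup V] [Module ℂ V] {A : VertexOperatorAlgebra V} {g : A.Aut}
variable {W : Type*} [AddCommGroup W] [Module ℂ W]

theorem mode_one (M : WeakTwistedModule A g W) (n : ℂ) (k : ℕ) :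
    (M.YW A.one).mode n k = if n = -1 ∧ k = 0 then 1 else 0 := by
  rw [LogSeries.mode, M.identity]
  congr 2
  rw [eq_iff_iff]
  constructor <;> intro h <;> linear_combination -h

/-- `(x₁-x₂)^l` is expanded in nonnegative powers of `x₂`, so `x₂⁻¹` does not occur. -/
theorem deltaFirst_one (M : WeakTwistedModule A g W) (u : V) (w : W) (l : ℤ) (p : ℂ) (j : ℕ) :
    deltaFirst (M.YW u) (M.YW A.one) w l p 0 j 0 = 0 := by
  refine finsum_eq_zero_of_forall_eq_zero fun i => ?_
  rw [M.mode_one, if_neg, LinearMap.zero_apply, map_zero, smul_zero]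
  rintro ⟨h, -⟩
  rw [zero_add] at h
  have := congrArg Complex.re h
  simp at this
  linarith [(Nat.cast_nonneg i : (0 : ℝ) ≤ i)]

/-- `(-x₂+x₁)⁻¹ = -x₂⁻¹ - x₁x₂⁻² - ⋯`, and only the leading term has `x₂⁻¹`. -/
theorem deltaSecond_neg_one_one (M : WeakTwistedModule A g W) (u : V) (w : W) (p : ℂ) (j : ℕ) :
    deltaSecond (M.YW u) (M.YW A.one) w (-1) p 0 j 0 = -(M.YW u).mode p j w := by
  rw [deltaSecond, finsum_eq_single _ 0]
  · simp [M.mode_one]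
  · intro i hi
    rw [M.mode_one, if_neg, LinearMap.zero_apply, smul_zero]
    rintro ⟨h, -⟩
    apply hi
    push_cast at h
    exact_mod_cast (by linear_combination -h : (i : ℂ) = 0)

/-- The expansion of `(-x₂+x₁)⁻²` starts at `x₂⁻²` and descends, so it has no `x₂⁻¹`. -/
theorem deltaSecond_neg_two_one (M : WeakTwistedModule A g W) (u : V) (w : W) (p : ℂ) (j : ℕ) :
    deltaSecond (M.YW u) (M.YW A.one) w (-2) p 0 j 0 = 0 := by
  refine finsum_eq_zero_of_forall_eq_zero fun i => ?_
  rw [M.mode_one, if_neg, LinearMap.zero_apply, smul_zero]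
  rintro ⟨h, -⟩
  push_cast at h
  have : (i : ℂ) + 1 = 0 := by linear_combination -h
  exact i.succ_ne_zero (by exact_mod_cast this)

/-- The twist contributes `x₁^(-α)` and the delta function only integral powers of `x₁`. -/
theorem deltaThird_of_notMem (M : WeakTwistedModule A g W) {α : LogStrip} {u : V}
    (hu : u ∈ g.genSpace α) (v : V) (w : W) (l : ℤ) {p : ℂ} (hp : ∀ m : ℤ, p ≠ α + m) (q : ℂ)
    (j k : ℕ) : deltaThird A g M.YW u v w l p q j k = 0 := by
  refine finsum_eq_zero_of_forall_eq_zero fun m => finsum_eq_zero_of_forall_eq_zero fun t => ?_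
  refine Finset.sum_eq_zero fun si _ => Finset.sum_eq_zero fun ab _ => ?_
  rw [g.ratioPow_apply_of_ne (fun h => hp m (by rw [h]; ring)) hu]
  simp [VertexAlgebra.mode, LogSeries.mode]

/-- Matching powers of `x₁` forces the summation index of the delta function to be `m`, and creation
kills every `t` with `l + t ≥ 0`. -/
theorem deltaThird_one (M : WeakTwistedModule A g W) {α : LogStrip} {u : V}
    (hu : u ∈ g.genSpace α) (w : W) (l m : ℤ) (q : ℂ) (j T : ℕ) (hT : 0 ≤ l + T) :
    deltaThird A g M.YW u A.one w l (α + m) q j 0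
      = ∑ t ∈ Finset.range T, ∑ si ∈ Finset.HasAntidiagonal.antidiagonal t,
        Ring.choose m si.1 • (M.YW (A.mode (g.ratioPow α si.2 j 0 u) (l + t) A.one)).mode
          (α + m + q - t) 0 w := by
  rw [deltaThird, finsum_eq_single _ m]
  · rw [finsum_eq_sum_of_support_subset (s := Finset.range T)]
    · simp
    · intro t ht
      by_contra hlt
      apply ht
      simp only [Finset.coe_range, Set.mem_Iio, not_lt] at hlt
      refine Finset.sum_eq_zero fun si _ => Finset.sum_eq_zero fun ab _ => ?_
      rw [A.mode_one_eq_zero _ (by omega)]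
      simp [LogSeries.mode]
  · intro m' hm
    refine finsum_eq_zero_of_forall_eq_zero fun t => ?_
    refine Finset.sum_eq_zero fun si _ => Finset.sum_eq_zero fun ab _ => ?_
    rw [g.ratioPow_apply_of_ne (fun h => hm ?_) hu]
    · simp [VertexAlgebra.mode, LogSeries.mode]
    · exact_mod_cast (by linear_combination h : (m' : ℂ) = m)

/-- The modes of `u ∈ V^[α]` are supported on `α + ℤ`. -/
theorem mode_eq_zero (M : WeakTwistedModule A g W) {α : LogStrip} {u : V}
    (hu : u ∈ g.genSpace α) {n : ℂ} (hn : ∀ m : ℤ, n ≠ α + m) (j : ℕ) :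
    (M.YW u).mode n j = 0 := by
  ext w
  -- At `l = -1`, `q = 0` the left side is exactly `u(n,j)w`.
  have h := M.jacobi u A.one w (-1) n 0 j 0
  rw [M.deltaFirst_one, M.deltaSecond_neg_one_one, M.deltaThird_of_notMem hu _ _ _ hn] at h
  simpa using h

/-- `Y_W(u, x) = Y_{W,0}(x^{-𝒩} u, x)`, where `Y_{W,0}` is the part of `Y_W` free of `log x`. -/
theorem mode_eq_mode_expNegN (M : WeakTwistedModule A g W) {α : LogStrip} {u : V}
    (hu : u ∈ g.genSpace α) (n : ℂ) (j : ℕ) :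
    (M.YW u).mode n j = (M.YW (g.expNegN j u)).mode n 0 := by
  by_cases hn : ∃ m : ℤ, n = α + m
  · obtain ⟨m, rfl⟩ := hn
    ext w
    -- One term, `t = 0`, survives on the right; there the twist reduces to the `(log x₁)^j`
    -- coefficient of `e^{-(log x₁)𝒩}`.
    have h := M.jacobi u A.one w (-1) (α + m) 0 j 0
    rw [M.deltaFirst_one, M.deltaSecond_neg_one_one,
      M.deltaThird_one hu w (-1) m 0 j 1 (by norm_num)] at h
    simpa [g.ratioPow_zero_zero hu, A.mode_neg_one_one] using h
  · push Not at hn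
    rw [M.mode_eq_zero hu hn, M.mode_eq_zero (g.expNegN_mem_genSpace hu j) hn]

theorem mode_zero_L_neg_one (M : WeakTwistedModule A g W) {α : LogStrip} {u : V}
    (hu : u ∈ g.genSpace α) (n : ℂ) :
    (M.YW (A.L (-1) u)).mode n 0 = -n • (M.YW u).mode (n - 1) 0 + (M.YW u).mode (n - 1) 1 := by
  by_cases hn : ∃ m : ℤ, n = α + m
  · obtain ⟨m, rfl⟩ := hn
    have hN : (M.YW u).mode (α + m - 1) 1 = -(M.YW (g.N u)).mode (α + m - 1) 0 := by
      rw [M.mode_eq_mode_expNegN hu, g.expNegN_one]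
      simp [LogSeries.mode]
    ext w
    -- The left side is now zero. On the right `t = 0` gives `L(-1)u`; `t = 1` gives `m u` when `x₀`
    -- comes from the delta function and `αu + 𝒩u` when it comes from the twist.
    have h := M.jacobi u A.one w (-2) (α + m) 0 0 0
    rw [M.deltaFirst_one, M.deltaSecond_neg_two_one,
      M.deltaThird_one hu w (-2) m 0 0 2 (by norm_num)] at h
    have he : g.expNegN 0 u = u := by simp [Aut.expNegN]
    simp [Finset.sum_range_succ, Finset.Nat.antidiagonal_succ, g.ratioPow_zero_zero hu,
      g.ratioPow_one_zero_zero hu, A.mode_neg_one_one, A.mode_neg_two_one, he] at h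
    rw [hN]
    simp only [LogSeries.mode, Finsupp.add_apply, Finsupp.smul_apply, Pi.add_apply, Pi.smul_apply,
      LinearMap.add_apply, LinearMap.neg_apply, LinearMap.smul_apply] at h ⊢
    rw [← Int.cast_smul_eq_zsmul ℂ] at h
    rw [← sub_eq_zero, h]
    module
  · push Not at hn
    -- Off the coset `α + ℤ`, which is stable under integer shifts, every mode involved vanishes.
    have hn' : ∀ m : ℤ, n - 1 ≠ α + m := fun m h =>
      hn (m + 1) (by push_cast; linear_combination h)
    rw [M.mode_eq_zero (g.L_mem_genSpace _ hu) hn, M.mode_eq_zero hu hn', M.mode_eq_zero hu hn']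
    simp

/-- On `V^[α]` the case of general `j` is the log-free case for `(-𝒩)^j/j! u`: the `(log x)^1` mode
of that vector is `j + 1` times the `(log x)^(j+1)` mode of `u`. -/
theorem mode_L_neg_one (M : WeakTwistedModule A g W) (u : V) (n : ℂ) (j : ℕ) :
    (M.YW (A.L (-1) u)).mode n j
      = -n • (M.YW u).mode (n - 1) j + (j + 1 : ℂ) • (M.YW u).mode (n - 1) (j + 1) := by
  refine g.genSpace_induction (P := fun u => (M.YW (A.L (-1) u)).mode n j
      = -n • (M.YW u).mode (n - 1) j + (j + 1 : ℂ) • (M.YW u).mode (n - 1) (j + 1))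
    (by simp [LogSeries.mode]) (fun v w hv hw => ?_) (fun α u hu => ?_) u
  · simp only [LogSeries.mode, map_add, Finsupp.add_apply, Pi.add_apply] at hv hw ⊢
    rw [hv, hw]
    module
  · have hj := g.expNegN_mem_genSpace hu j
    rw [M.mode_eq_mode_expNegN (g.L_mem_genSpace _ hu), g.expNegN_L, M.mode_zero_L_neg_one hj,
      M.mode_eq_mode_expNegN hj _ 1, M.mode_eq_mode_expNegN hu _ j,
      M.mode_eq_mode_expNegN hu _ (j + 1), ← Module.End.mul_apply, g.expNegN_one_mul]
    simp [LogSeries.mode]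

end VertexOperatorAlgebra.WeakTwistedModule

/-- Every weak `g`-twisted `V`-module has the `L(-1)`-derivative property
`Y_W(L(-1)u, x) = d/dx Y_W(u, x)`. -/
theorem mainTheorem3 {V : Type*} [AddCommGroup V] [Module ℂ V] (A : VertexOperatorAlgebra V)
    (g : A.Aut) {W : Type*} [AddCommGroup W] [Module ℂ W]
    (M : VertexOperatorAlgebra.WeakTwistedModule A g W) (u : V) :
    M.YW (A.L (-1) u) = (M.YW u).deriv :=
  LogSeries.ext_mode fun n k => by rw [M.mode_L_neg_one, LogSeries.deriv_mode]
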